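/- Let $\mathcal X$ be a finite set and let $\mathcal X^\infty$ be the set of one-way infinite sequences over $\mathcal X$, with the $\sigma$-field $\mathcal F$ generated by the cylinder sets $[x_{1..n}]$ (the set of all infinite sequences that start with $x_1,\dots,x_n$). For probability measures $\mu,\rho$ on $(\mathcal X^\infty,\mathcal F)$ put $$v(\mu,\rho,x_{1..n}) := \sup_{A\in\mathcal F}\bigl|\rho(A\mid x_{1..n})-\mu(A\mid x_{1..n})\bigr|,$$ where $\rho(A\mid x_{1..n})=\rho(A\cap[x_{1..n}])/\rho([x_{1..n}])$, read as $0$ if $\rho([x_{1..n}])=0$, and likewise for $\mu$. Say that $\rho$ predicts $\mu$ in total variation if $v(\mu,\rho,x_{1..n})\to 0$ as $n\to\infty$ for $\mu$-almost every sequence $x_1,x_2,\dots$. Theorem. Let $\mathcal C$ be a non-empty set of probability measures on $(\mathcal X^\infty,\mathcal F)$. If there is a probability measure $\rho$ on $(\mathcal X^\infty,\mathcal F)$ that predicts every $\mu\in\mathcal C$ in total variation, then there is a sequence $\mu_k\in\mathcal C$, $k\in\mathbb N$ (not necessarily of distinct measures), such that for all positive real weights $w_k$, $k\in\mathbb N$,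 with $\sum_{k\in\mathbb N} w_k=1$, the measure $\nu:=\sum_{k\in\mathbb N} w_k\mu_k$ predicts every $\mu\in\mathcal C$ in total variation. -/

import Mathlib

open MeasureTheory ProbabilityTheory Filter
open scoped Topology

/-- The total variation distance between the `ρ`- and the `μ`-conditional probabilities given the
first `n` symbols of `x`: the supremum over all measurable `A` of
`|ρ(A | x_1, …, x_n) - μ(A | x_1, …, x_n)|`. The set `PiNat.cylinder x n` consists of all the
sequences that agree with `x` in the first `n` places. Conditioning a measure on an event of
measure zero gives the zero measure, so this distance equals `1` if `x_1, …, x_n` has positive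
`μ`-probability and `ρ`-probability zero. -/
noncomputable def tvDist {X : Type*} [MeasurableSpace X] (μ ρ : Measure (ℕ → X))
    (x : ℕ → X) (n : ℕ) : ℝ :=
  ⨆ A : {A : Set (ℕ → X) // MeasurableSet A},
    |(ρ[|PiNat.cylinder x n]).real A.1 - (μ[|PiNat.cylinder x n]).real A.1|

/-- `ρ` predicts `μ` in total variation: the total variation distance between the conditional
probabilities given the first `n` symbols tends to `0` for `μ`-almost every sequence. -/
def PredictsInTV {X : Type*} [MeasurableSpace X] (ρ μ : Measure (ℕ → X)) : Prop :=
  ∀ᵐ x ∂μ, Tendsto (fun n => tvDist μ ρ x n) atTop (𝓝 0)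

namespace PiNat

variable {X : Type*}

/-! For finite measures over a finite alphabet, prediction in total variation is the same as
absolute continuity `μ ≪ ρ`. Both directions rest on Lévy's theorem for cylinder averages:
`PredictsInTV.absolutelyContinuous` applies it to indicators, `predictsInTV_of_absolutelyContinuous`
to the density and its distance from cylinder-constant approximations. What remains is the
Halmos–Savage lemma: countably many supports of densities with respect to `ρ` exhaust all the others
up to `ρ`-null sets. A mixture of the corresponding measures with positive weights then dominates
all of `C`. -/

theorem countable_range_cylinder [Finite X] (n : ℕ) :
    (Set.range fun x : ℕ → X => cylinder x n).Countable := by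
  have : (Set.range fun x : ℕ → X => cylinder x n) ⊆
      Set.range fun u : Fin n → X => {y : ℕ → X | ∀ i : Fin n, y i = u i} := by
    rintro _ ⟨x, rfl⟩
    refine ⟨fun i => x i, ?_⟩
    ext y
    simp only [Set.mem_ofPred_eq, mem_cylinder_iff]
    exact ⟨fun h i hi => h ⟨i, hi⟩, fun h i => h i i.2⟩
  exact (Set.finite_range _).countable.mono this

variable [MeasurableSpace X]

variable (X) in
/-- The filtration on sequences whose `n`-th term is generated by the first `n` symbols. -/
def cylinderFiltration : Filtration ℕ (inferInstance : MeasurableSpace (ℕ → X)) where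
  seq n := ⨆ i ∈ Set.Iio n, MeasurableSpace.comap (fun x : ℕ → X => x i) inferInstance
  mono' _ _ h := biSup_mono fun _ hi => lt_of_lt_of_le hi h
  le' _ := iSup₂_le fun i _ => (measurable_pi_apply i).comap_le

theorem iSup_cylinderFiltration :
    ⨆ n, cylinderFiltration X n = (inferInstance : MeasurableSpace (ℕ → X)) := by
  refine le_antisymm (iSup_le (cylinderFiltration X).le) (iSup_le fun i => ?_)
  refine le_trans ?_ (le_iSup (fun n => (cylinderFiltration X n : MeasurableSpace (ℕ → X))) (i + 1))
  exact le_iSup₂_of_le (f := fun i (_ : i ∈ Set.Iio _) =>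
    MeasurableSpace.comap (fun x : ℕ → X => x i) inferInstance) i (Nat.lt_succ_self i) le_rfl

/-- Every set in the `n`-th σ-algebra is a preimage under restriction to the first `n` coordinates.
-/
theorem mem_iff_of_mem_cylinder {n : ℕ} {s : Set (ℕ → X)}
    (hs : MeasurableSet[cylinderFiltration X n] s) {x y : ℕ → X} (hy : y ∈ cylinder x n) :
    y ∈ s ↔ x ∈ s := by
  have hle : (cylinderFiltration X n : MeasurableSpace (ℕ → X)) ≤
      MeasurableSpace.comap (fun (z : ℕ → X) (i : Set.Iio n) => z i) ⊤ := by
    refine iSup₂_le fun i hi => ?_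
    rintro _ ⟨t, -, rfl⟩
    exact ⟨{z | z ⟨i, hi⟩ ∈ t}, trivial, rfl⟩
  obtain ⟨t, -, rfl⟩ := hle _ hs
  have : (fun i : Set.Iio n => y i) = fun i : Set.Iio n => x i := funext fun i => hy i i.2
  simp [this]

theorem eq_of_mem_cylinder {n : ℕ} {g : (ℕ → X) → ℝ}
    (hg : StronglyMeasurable[cylinderFiltration X n] g) {x y : ℕ → X} (hy : y ∈ cylinder x n) :
    g y = g x :=
  (mem_iff_of_mem_cylinder (hg.measurable (measurableSet_singleton (g x))) hy).2 rfl

theorem ae_measure_cylinder_ne_zero [Finite X] (ν : Measure (ℕ → X)) :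
    ∀ᵐ x ∂ν, ∀ n, ν (cylinder x n) ≠ 0 := by
  refine ae_all_iff.2 fun n => ?_
  have hs : ν (⋃ s ∈ (Set.range fun x : ℕ → X => cylinder x n) ∩ {s | ν s = 0}, s) = 0 :=
    (measure_biUnion_null_iff ((countable_range_cylinder n).mono Set.inter_subset_left)).2
      fun s hs => hs.2
  refine measure_mono_null (fun x hx => ?_) hs
  simp only [Set.mem_compl_iff, Set.mem_ofPred_eq, not_not] at hx
  exact Set.mem_biUnion ⟨⟨x, rfl⟩, hx⟩ (self_mem_cylinder x n)

theorem ae_tendsto_condExp_cylinderFiltration (ν : Measure (ℕ → X)) [IsFiniteMeasure ν]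
    {g : (ℕ → X) → ℝ} (hg : Integrable g ν) :
    ∀ᵐ x ∂ν, Tendsto (fun n => (ν[g | cylinderFiltration X n]) x) atTop (𝓝 (g x)) := by
  have hlim := tendsto_ae_condExp (μ := ν) (ℱ := cylinderFiltration X) g
  rw [iSup_cylinderFiltration] at hlim
  filter_upwards [hlim, condExp_of_aestronglyMeasurable' le_rfl hg.1 hg] with x hx hxg
  rwa [hxg] at hx

variable [DiscreteMeasurableSpace X]

theorem measurableSet_cylinder (x : ℕ → X) (n : ℕ) : MeasurableSet (cylinder x n) := by
  rw [cylinder_eq_pi]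
  exact MeasurableSet.pi (Finset.countable_toSet _) fun _ _ => .of_discrete

theorem measurableSet_cylinderFiltration_cylinder (x : ℕ → X) (n : ℕ) :
    MeasurableSet[cylinderFiltration X n] (cylinder x n) := by
  have h : cylinder x n = ⋂ i ∈ Set.Iio n, (fun y : ℕ → X => y i) ⁻¹' {x i} := by
    ext y; simp [cylinder]
  rw [h]
  refine MeasurableSet.biInter (Set.to_countable _) fun i hi => ?_
  have hle : MeasurableSpace.comap (fun x : ℕ → X => x i) inferInstance ≤
      cylinderFiltration X n :=
    le_iSup₂_of_le (f := fun i (_ : i ∈ Set.Iio n) =>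
      MeasurableSpace.comap (fun x : ℕ → X => x i) inferInstance) i hi le_rfl
  exact hle _ ⟨{x i}, .of_discrete, rfl⟩

/-- Lévy's upward theorem for the averages over the cylinders around a point. -/
theorem ae_tendsto_setAverage_cylinder [Finite X] (ν : Measure (ℕ → X)) [IsFiniteMeasure ν]
    {g : (ℕ → X) → ℝ} (hg : Integrable g ν) :
    ∀ᵐ x ∂ν, Tendsto (fun n => ⨍ y in cylinder x n, g y ∂ν) atTop (𝓝 (g x)) := by
  filter_upwards [ae_tendsto_condExp_cylinderFiltration ν hg, ae_measure_cylinder_ne_zero ν]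
    with x hx hpos
  refine hx.congr fun n => ?_
  have hint := setIntegral_condExp ((cylinderFiltration X).le n) hg
    (measurableSet_cylinderFiltration_cylinder x n)
  -- The conditional expectation is constant on the cylinder, so its integral there is its value at
  -- `x` times the mass.
  rw [setIntegral_congr_fun (measurableSet_cylinder x n)
    (fun y hy => eq_of_mem_cylinder stronglyMeasurable_condExp hy), setIntegral_const] at hint
  have hne : ν.real (cylinder x n) ≠ 0 := (measureReal_ne_zero_iff).2 (hpos n)
  rw [setAverage_eq, ← hint, smul_smul, inv_mul_cancel₀ hne, one_smul]

end PiNat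

theorem cond_real_eq_setAverage_indicator {Ω : Type*} [MeasurableSpace Ω] (μ : Measure Ω)
    {c A : Set Ω} (hc : MeasurableSet c) (hA : MeasurableSet A) :
    (μ[|c]).real A = ⨍ y in c, A.indicator 1 y ∂μ := by
  rw [setAverage_eq, integral_indicator_one hA, measureReal_restrict_apply hA, smul_eq_mul,
    measureReal_def, cond_apply hc, ENNReal.toReal_mul, ENNReal.toReal_inv, Set.inter_comm]
  rfl

/-- The difference is the integral over `c ∩ A` of `a - f`, divided by `a * ν c`, where `f` is the
density and `a` its average on `c`. Since `a` varies with the cylinder, Lévy's theorem does not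
apply to `|f - a|` directly; the free constant `b` mediates. -/
theorem abs_cond_real_sub_le {Ω : Type*} [MeasurableSpace Ω] {μ ν : Measure Ω}
    [IsFiniteMeasure μ] [IsFiniteMeasure ν] (hμν : μ ≪ ν) {c A : Set Ω} (hc : MeasurableSet c)
    (hν : ν c ≠ 0) (b : ℝ)
    (ha : 0 < ⨍ y in c, (μ.rnDeriv ν y).toReal ∂ν) :
    |(ν[|c]).real A - (μ[|c]).real A| ≤
      ((⨍ y in c, |(μ.rnDeriv ν y).toReal - b| ∂ν) +
        |b - ⨍ y in c, (μ.rnDeriv ν y).toReal ∂ν|) / ⨍ y in c, (μ.rnDeriv ν y).toReal ∂ν := by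
  set f : Ω → ℝ := fun y => (μ.rnDeriv ν y).toReal with hf
  set a := ⨍ y in c, f y ∂ν with hadef
  have hN : 0 < ν.real c := measureReal_nonneg.lt_of_ne' ((measureReal_ne_zero_iff).2 hν)
  have hfi : Integrable f ν := Measure.integrable_toReal_rnDeriv
  have hμ : ∀ s, μ.real s = ∫ y in s, f y ∂ν := fun s =>
    (Measure.setIntegral_toReal_rnDeriv hμν s).symm
  have hμc : μ.real c = a * ν.real c := by
    rw [hμ, hadef, setAverage_eq, smul_eq_mul]
    field_simp
  have hcond : ∀ κ : Measure Ω, (κ[|c]).real A = κ.real (c ∩ A) / κ.real c := fun κ => by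
    rw [measureReal_def, cond_apply hc, ENNReal.toReal_mul, ENNReal.toReal_inv, div_eq_inv_mul]
    rfl
  have hconst : ∀ (s : Set Ω) (t : ℝ), IntegrableOn (fun _ => t) s ν := fun s t =>
    (integrable_const t).integrableOn
  have hdiff : (ν[|c]).real A - (μ[|c]).real A =
      (∫ y in c ∩ A, (a - f y) ∂ν) / (a * ν.real c) := by
    rw [hcond, hcond, hμc, hμ, integral_sub (hconst _ _) hfi.integrableOn, setIntegral_const,
      smul_eq_mul]
    field_simp
  have hbound : |∫ y in c ∩ A, (a - f y) ∂ν| ≤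
      (∫ y in c, |f y - b| ∂ν) + |b - a| * ν.real c := by
    calc |∫ y in c ∩ A, (a - f y) ∂ν| ≤ ∫ y in c ∩ A, |a - f y| ∂ν := abs_integral_le_integral_abs
      _ ≤ ∫ y in c, |a - f y| ∂ν :=
        setIntegral_mono_set (((integrable_const a).sub hfi).abs.integrableOn)
          (ae_of_all _ fun _ => abs_nonneg _) Set.inter_subset_left.eventuallyLE
      _ ≤ ∫ y in c, (|f y - b| + |b - a|) ∂ν := by
        refine setIntegral_mono (((integrable_const a).sub hfi).abs.integrableOn)
          ((hfi.sub (integrable_const b)).abs.add (integrable_const _)).integrableOn fun y => ?_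
        rw [abs_sub_comm a]
        exact abs_sub_le _ _ _
      _ = _ := by
        have hint : IntegrableOn (fun y => |f y - b|) c ν :=
          (hfi.sub (integrable_const b)).abs.integrableOn
        rw [integral_add hint (hconst _ _), setIntegral_const, smul_eq_mul, mul_comm |b - a|]
  rw [hdiff, abs_div, abs_of_pos (mul_pos ha hN), setAverage_eq, smul_eq_mul]
  calc _ ≤ ((∫ y in c, |f y - b| ∂ν) + |b - a| * ν.real c) / (a * ν.real c) := by gcongr
    _ = ((ν.real c)⁻¹ * (∫ y in c, |f y - b| ∂ν) + |b - a|) / a := by field_simp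

theorem bddAbove_tvDist_range {X : Type*} [MeasurableSpace X] (μ ρ : Measure (ℕ → X))
    (x : ℕ → X) (n : ℕ) :
    BddAbove (Set.range fun A : {A : Set (ℕ → X) // MeasurableSet A} =>
      |(ρ[|PiNat.cylinder x n]).real A.1 - (μ[|PiNat.cylinder x n]).real A.1|) := by
  refine ⟨1, ?_⟩
  rintro _ ⟨A, rfl⟩
  exact abs_sub_le_of_le_of_le measureReal_nonneg measureReal_le_one measureReal_nonneg
    measureReal_le_one |>.trans (by norm_num)

section PredictsInTV

variable {X : Type*} [Finite X] [MeasurableSpace X] [DiscreteMeasurableSpace X]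

/-- Prediction in total variation implies absolute continuity. -/
theorem PredictsInTV.absolutelyContinuous {μ ρ : Measure (ℕ → X)} [IsFiniteMeasure μ]
    (h : PredictsInTV ρ μ) : μ ≪ ρ := by
  refine Measure.AbsolutelyContinuous.mk fun A hA hρA => ?_
  have hint : Integrable (A.indicator (1 : (ℕ → X) → ℝ)) μ :=
    (integrable_const (1 : ℝ)).indicator hA
  rw [measure_eq_zero_iff_ae_notMem]
  filter_upwards [h, PiNat.ae_tendsto_setAverage_cylinder μ hint] with x hx hlim hxA
  -- As `ρ A = 0`, the distance dominates `μ(A | x_1, …, x_n)`, whose limit is `1` at almost every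
  -- point of `A`.
  have hle : ∀ n, ⨍ y in PiNat.cylinder x n, A.indicator 1 y ∂μ ≤ tvDist μ ρ x n := by
    intro n
    have hρ : (ρ[|PiNat.cylinder x n]).real A = 0 := by
      rw [measureReal_def, cond_absolutelyContinuous hρA, ENNReal.toReal_zero]
    have := le_ciSup (bddAbove_tvDist_range μ ρ x n) ⟨A, hA⟩
    simp only [hρ, zero_sub, abs_neg] at this
    rw [← cond_real_eq_setAverage_indicator μ (PiNat.measurableSet_cylinder x n) hA]
    exact (le_abs_self _).trans this
  have := le_of_tendsto_of_tendsto' hlim hx hle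
  simp only [Set.indicator_of_mem hxA, Pi.one_apply] at this
  linarith

/-- The Blackwell–Dubins theorem: absolute continuity implies prediction in total variation. -/
theorem predictsInTV_of_absolutelyContinuous {μ ν : Measure (ℕ → X)} [IsFiniteMeasure μ]
    [IsFiniteMeasure ν] (hμν : μ ≪ ν) : PredictsInTV ν μ := by
  set f : (ℕ → X) → ℝ := fun y => (μ.rnDeriv ν y).toReal with hf
  have hfi : Integrable f ν := Measure.integrable_toReal_rnDeriv
  -- `h m` is constant on cylinders of depth at least `m`, so there it serves as `b`; only countably
  -- many exceptional null sets arise.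
  let h : ℕ → (ℕ → X) → ℝ := fun m => ν[f | PiNat.cylinderFiltration X m]
  have hh : ∀ᵐ x ∂ν, Tendsto (fun m => h m x) atTop (𝓝 (f x)) :=
    PiNat.ae_tendsto_condExp_cylinderFiltration ν hfi
  have hdist : ∀ᵐ x ∂ν, ∀ m, Tendsto (fun n => ⨍ y in PiNat.cylinder x n, |f y - h m y| ∂ν) atTop
      (𝓝 |f x - h m x|) :=
    ae_all_iff.2 fun m => PiNat.ae_tendsto_setAverage_cylinder ν (hfi.sub integrable_condExp).abs
  filter_upwards [hμν.ae_le hh, hμν.ae_le hdist, Measure.rnDeriv_pos hμν,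
    hμν.ae_le (Measure.rnDeriv_lt_top μ ν), hμν.ae_le (PiNat.ae_tendsto_setAverage_cylinder ν hfi),
    hμν.ae_le (PiNat.ae_measure_cylinder_ne_zero ν)] with x hhx hdx hpos hfin hax hcyl
  have hfx : 0 < f x := ENNReal.toReal_pos hpos.ne' hfin.ne
  rw [Metric.tendsto_atTop']
  intro ε hε
  -- For fixed `m`, this quotient is the limit as `n → ∞` of the bound with `b = h m x`.
  have hlim : Tendsto (fun m => (|f x - h m x| + |h m x - f x|) / f x) atTop (𝓝 0) := by
    have := ((hhx.const_sub (f x)).abs.add (hhx.sub_const (f x)).abs).div_const (f x)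
    simpa using this
  obtain ⟨m, hm⟩ := (hlim.eventually_lt_const hε).exists
  have hlim' := ((hdx m).add (hax.const_sub (h m x)).abs).div hax hfx.ne'
  obtain ⟨N, hN⟩ := eventually_atTop.1 ((hlim'.eventually_lt_const hm).and
    ((hax.eventually_const_lt hfx).and (eventually_ge_atTop m)))
  refine ⟨N, fun n hn => ?_⟩
  obtain ⟨hlt, ha, hmn⟩ := hN n hn.le
  have hnonneg : 0 ≤ tvDist μ ν x n := Real.iSup_nonneg fun _ => abs_nonneg _
  rw [Real.dist_eq, sub_zero, abs_of_nonneg hnonneg]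
  refine lt_of_le_of_lt ?_ hlt
  have : Nonempty {A : Set (ℕ → X) // MeasurableSet A} := ⟨⟨∅, .empty⟩⟩
  refine ciSup_le fun A => ?_
  refine (abs_cond_real_sub_le hμν (PiNat.measurableSet_cylinder x n) (hcyl n) (h m x)
    ha).trans_eq ?_
  have hcongr : ⨍ y in PiNat.cylinder x n, |f y - h m y| ∂ν =
      ⨍ y in PiNat.cylinder x n, |f y - h m x| ∂ν := by
    rw [setAverage_eq, setAverage_eq]
    congr 1
    refine setIntegral_congr_fun (PiNat.measurableSet_cylinder x n) fun y hy => ?_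
    have : h m y = h m x := PiNat.eq_of_mem_cylinder stronglyMeasurable_condExp
      (PiNat.cylinder_anti x hmn hy)
    simp only [this]
  simp only [Pi.div_apply]
  rw [hcongr]

end PredictsInTV

/-- A family of sets has a countable subfamily whose union contains each of them up to a
null set. -/
theorem exists_seq_measure_diff_iUnion_eq_zero {Ω ι : Type*} [MeasurableSpace Ω] [Nonempty ι]
    (ρ : Measure Ω) [IsFiniteMeasure ρ] {S : ι → Set Ω} (hS : ∀ i, MeasurableSet (S i)) :
    ∃ m : ℕ → ι, ∀ i, ρ (S i \ ⋃ k, S (m k)) = 0 := by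
  let V : Set ENNReal := Set.range fun m : ℕ → ι => ρ (⋃ k, S (m k))
  obtain ⟨u, -, hu, huV⟩ := exists_seq_tendsto_sSup (Set.range_nonempty _ : V.Nonempty)
    (OrderTop.bddAbove V)
  choose M hM using huV
  -- Merging a maximizing sequence of countable subfamilies into one attains the supremum.
  let m : ℕ → ι := fun k => M k.unpair.1 k.unpair.2
  have hsub : ∀ j, ⋃ k, S (M j k) ⊆ ⋃ k, S (m k) := fun j =>
    Set.iUnion_subset fun k => by
      have : S (M j k) = S (m (Nat.pair j k)) := by simp [m]
      exact this ▸ Set.subset_iUnion (fun k => S (m k)) (Nat.pair j k)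
  have hsup : sSup V ≤ ρ (⋃ k, S (m k)) :=
    le_of_tendsto' hu fun j => (hM j).symm.le.trans (measure_mono (hsub j))
  refine ⟨m, fun i => ?_⟩
  -- Prepending `i` to `m` gives another competitor for the supremum.
  have hle : ρ (S i ∪ ⋃ k, S (m k)) ≤ ρ (⋃ k, S (m k)) := by
    refine (le_of_eq ?_).trans ((le_sSup (Set.mem_range_self fun k => Nat.casesOn k i m)).trans hsup)
    congr 1
    ext y
    simp only [Set.mem_iUnion, Set.mem_union]
    constructor
    · rintro (hk | ⟨k, hk⟩)
      exacts [⟨0, hk⟩, ⟨k + 1, hk⟩]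
    · rintro ⟨_ | k, hk⟩
      exacts [.inl hk, .inr ⟨k, hk⟩]
  rw [← Set.sdiff_union_self, measure_union Set.disjoint_sdiff_left
    (MeasurableSet.iUnion fun k => hS (m k))] at hle
  by_contra hne
  exact absurd hle (not_le.2 (by
    rw [add_comm]; exact ENNReal.lt_add_right (measure_ne_top _ _) hne))

/-- The Halmos–Savage lemma: in a dominated family of finite measures some sequence has the
same null sets as the whole family. -/
theorem exists_seq_forall_measure_eq_zero {Ω ι : Type*} [MeasurableSpace Ω] [Nonempty ι]
    (ρ : Measure Ω) [IsFiniteMeasure ρ] (μ : ι → Measure Ω) [∀ i, IsFiniteMeasure (μ i)]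
    (hμ : ∀ i, μ i ≪ ρ) :
    ∃ m : ℕ → ι, ∀ i A, MeasurableSet A → (∀ k, μ (m k) A = 0) → μ i A = 0 := by
  let S : ι → Set Ω := fun i => {x | (μ i).rnDeriv ρ x ≠ 0}
  have hS : ∀ i, MeasurableSet (S i) := fun i =>
    (Measure.measurable_rnDeriv (μ i) ρ (measurableSet_singleton 0)).compl
  obtain ⟨m, hm⟩ := exists_seq_measure_diff_iUnion_eq_zero ρ hS
  refine ⟨m, fun i A hA hnull => ?_⟩
  -- Each density vanishes `ρ`-almost everywhere on a set that is null for its measure.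
  have hρA : ρ (⋃ k, A ∩ S (m k)) = 0 := by
    refine measure_iUnion_null fun k => ?_
    have hk := hnull k
    rw [← Measure.setLIntegral_rnDeriv (hμ (m k)) A,
      setLIntegral_eq_zero_iff hA (Measure.measurable_rnDeriv _ _), ae_iff] at hk
    convert hk using 2
    ext y
    simp [S]
  have hcompl : μ i (S i)ᶜ = 0 := by
    have := Measure.rnDeriv_pos (hμ i)
    filter_upwards [this] with x hx
    simpa [S] using hx.ne'
  refine measure_mono_null (t := (S i)ᶜ ∪ ((S i \ ⋃ k, S (m k)) ∪ ⋃ k, A ∩ S (m k)))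
    (fun y hy => ?_)
    (measure_union_null hcompl (measure_union_null (hμ i (hm i)) (hμ i hρA)))
  by_cases h1 : y ∈ S i
  · by_cases h2 : y ∈ ⋃ k, S (m k)
    · obtain ⟨k, hk⟩ := Set.mem_iUnion.1 h2
      exact .inr (.inr (Set.mem_iUnion.2 ⟨k, hy, hk⟩))
    · exact .inr (.inl ⟨h1, h2⟩)
  · exact .inl h1

theorem theorem1 {X : Type*} [Finite X] [MeasurableSpace X] [DiscreteMeasurableSpace X]
    (C : Set (ProbabilityMeasure (ℕ → X))) (hC : C.Nonempty)
    (hρ : ∃ ρ : ProbabilityMeasure (ℕ → X),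
      ∀ μ ∈ C, PredictsInTV (ρ : Measure (ℕ → X)) (μ : Measure (ℕ → X))) :
    ∃ m : ℕ → ProbabilityMeasure (ℕ → X), (∀ k, m k ∈ C) ∧
      ∀ w : ℕ → ℝ, (∀ k, 0 < w k) → HasSum w 1 →
        ∀ μ ∈ C, PredictsInTV
          (Measure.sum fun k => ENNReal.ofReal (w k) • (m k : Measure (ℕ → X)))
          (μ : Measure (ℕ → X)) := by
  obtain ⟨ρ, hρ⟩ := hρ
  have := hC.to_subtype
  obtain ⟨m, hm⟩ := exists_seq_forall_measure_eq_zero (ρ : Measure (ℕ → X))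
    (fun μ : C => ((μ : ProbabilityMeasure (ℕ → X)) : Measure (ℕ → X)))
    fun μ => (hρ μ μ.2).absolutelyContinuous
  refine ⟨fun k => m k, fun k => (m k).2, fun w hw hsum μ hμ => ?_⟩
  have : IsFiniteMeasure
      (Measure.sum fun k => ENNReal.ofReal (w k) • ((m k).1 : Measure (ℕ → X))) := by
    refine ⟨?_⟩
    rw [Measure.sum_apply _ .univ]
    simp only [Measure.smul_apply, measure_univ, smul_eq_mul, mul_one]
    rw [← ENNReal.ofReal_tsum_of_nonneg (fun k => (hw k).le) hsum.summable]
    exact ENNReal.ofReal_lt_top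
  refine predictsInTV_of_absolutelyContinuous (Measure.AbsolutelyContinuous.mk fun A hA hnull => ?_)
  refine hm ⟨μ, hμ⟩ A hA fun k => ?_
  -- Positive weights make every null set of the mixture null for each `m k`; `m` was chosen before
  -- the weights.
  rw [Measure.sum_apply_eq_zero] at hnull
  simpa [(hw k).not_ge] using hnull k
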